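/- **Setting.** There are $N$ threads sharing one unit of a resource. An allocation is a vector $m\in[0,\infty)^N$ with $\sum_i m_i\le 1$. For parameters $\gamma\in[0,1]^N$ and a known curvature $\beta\in[0,1]$ shared by all threads, write $\rho(\gamma,m)=\sum_{i=1}^N\gamma_i m_i^{\beta}$ (with $0^0=1$). In round $t=1,2,\dots,T$ an allocation $m_t$ is chosen on the basis of the information $\mathcal F_{t-1}$ available before that round, and then rewards $s_{t,1},\dots,s_{t,N}\in[0,1]$ are observed, where $\mathbb E[s_{t,i}\mid\mathcal F_{t-1}]=\gamma_i m_{t,i}^{\beta}$. Let $m^*$ be an allocation that maximizes $\rho(\gamma,\cdot)$ over all allocations. The expected regret is $\mathcal R_T=\mathbb E\sum_{t=1}^T\bigl(\rho(\gamma,m^*)-\rho(\gamma,m_t)\bigr)$. **Algorithm UCB-RA** (input $\beta$). In round $t\le N$ the whole resource is allocated to thread $t$. In each round $t\ge N+1$ compute $$\hat\gamma_{t,i}=\frac{\sum_{\tau=1}^{t-1}m_{\tau,i}^{\beta}s_{\tau,i}}{\sum_{\tau=1}^{t-1}m_{\tau,i}^{2\beta}},\qquad \widetilde\gamma_{t,i}=\min\{1,\hat\gamma_{t,i}\}+t^{-\eta},\qquad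 \eta=\frac{1-\beta}{2},$$ and choose as $m_t$ an allocation that maximizes $\rho(\widetilde\gamma_t,\cdot)$ over all allocations. **Theorem.** The expected regret of UCB-RA is $\widetilde{\mathcal O}\bigl(F(N,\beta)+T^{(1+\beta)/2}\bigr)$, where $F$ depends on $N$ and $\beta$ but not on $T$. Precisely, there are absolute constants $C>0$ and $k\in\mathbb N$ and a function $F\ge 0$ of $(N,\beta)$ such that for all $N$, all $\beta\in[0,1]$, all $\gamma\in[0,1]^N$, all reward processes as above and all $T\ge 1$, $$\mathcal R_T\le C\,\bigl(F(N,\beta)+T^{(1+\beta)/2}\bigr)\,(1+\log T)^k .$$ -/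

import Mathlib

open MeasureTheory

namespace UCBRA

noncomputable section

/-- The feasible allocations of one unit of resource to `N` threads. -/
def allocations (N : ℕ) : Set (Fin N → ℝ) :=
  {m | (∀ i, 0 ≤ m i) ∧ ∑ i, m i ≤ 1}

/-- The expected reward `ρ(γ, m) = ∑ i, γ i * m i ^ β` of the allocation `m` under the parameters
`γ` and the shared curvature `β` (with the convention `0 ^ 0 = 1`). -/
def expectedReward {N : ℕ} (β : ℝ) (γ m : Fin N → ℝ) : ℝ :=
  ∑ i, γ i * m i ^ β

/-- `m` maximizes the expected reward under the parameters `γ` among all feasible allocations. -/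
def IsOptimalAllocation {N : ℕ} (β : ℝ) (γ m : Fin N → ℝ) : Prop :=
  m ∈ allocations N ∧ ∀ m' ∈ allocations N, expectedReward β γ m' ≤ expectedReward β γ m

/-- The least-squares estimate of the parameter of thread `i` that is available at the beginning
of round `t`, that is, computed from the allocations `m` and the rewards `s` of the rounds
`1, …, t - 1`. -/
def estimate {N : ℕ} (β : ℝ) (m s : ℕ → Fin N → ℝ) (t : ℕ) (i : Fin N) : ℝ :=
  (∑ τ ∈ Finset.Ico 1 t, m τ i ^ β * s τ i) / ∑ τ ∈ Finset.Ico 1 t, m τ i ^ (2 * β)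

/-- The confidence width `t ^ (-η)` with `η = (1 - β) / 2`. -/
def confidenceWidth (β : ℝ) (t : ℕ) : ℝ :=
  (t : ℝ) ^ (-((1 - β) / 2))

/-- The upper confidence bound on the parameter of thread `i` used in round `t`. -/
def ucb {N : ℕ} (β : ℝ) (m s : ℕ → Fin N → ℝ) (t : ℕ) (i : Fin N) : ℝ :=
  min 1 (estimate β m s t i) + confidenceWidth β t

/-- The allocations `m 1, …, m T` are those that UCB-RA makes when the rewards are `s 1, …, s T`.
In the rounds `t = 1, …, N` everything goes to the `t`-th thread (threads are numbered from `0`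
in `Fin N`). In every later round the allocation is optimal for the upper confidence bounds. -/
structure IsPlay {N : ℕ} (β : ℝ) (T : ℕ) (m s : ℕ → Fin N → ℝ) : Prop where
  init : ∀ t, 1 ≤ t → t ≤ T → t ≤ N → ∀ i : Fin N, m t i = if t = (i : ℕ) + 1 then 1 else 0
  step : ∀ t, N + 1 ≤ t → t ≤ T → IsOptimalAllocation β (ucb β m s t) (m t)

/-- The stochastic model of the rewards over `T` rounds. `ℱ t` is the information after round `t`;
the allocation of round `t + 1` is chosen on the basis of `ℱ t`, and, given `ℱ t`, the reward of
thread `i` in round `t + 1` is a random number in `[0, 1]` with mean `γ i * (m (t + 1) i) ^ β`. -/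
structure IsRewardModel {N : ℕ} {Ω : Type*} {mΩ : MeasurableSpace Ω} (μ : Measure Ω)
    (ℱ : Filtration ℕ mΩ) (β : ℝ) (γ : Fin N → ℝ) (T : ℕ) (m s : ℕ → Ω → Fin N → ℝ) : Prop where
  allocation_measurable : ∀ t < T, ∀ i, Measurable[ℱ t] (fun ω => m (t + 1) ω i)
  reward_measurable : ∀ t < T, ∀ i, Measurable[ℱ (t + 1)] (fun ω => s (t + 1) ω i)
  reward_mem : ∀ t < T, ∀ i ω, s (t + 1) ω i ∈ Set.Icc (0 : ℝ) 1
  reward_mean : ∀ t < T, ∀ i,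
    μ[fun ω => s (t + 1) ω i | ℱ t] =ᵐ[μ] fun ω => γ i * m (t + 1) ω i ^ β

/-- The cumulative regret over the rounds `1, …, T` of the allocations `m` relative to the fixed
allocation `mStar`. -/
def regret {N : ℕ} (β : ℝ) (γ mStar : Fin N → ℝ) (T : ℕ) (m : ℕ → Fin N → ℝ) : ℝ :=
  ∑ t ∈ Finset.Icc 1 T, (expectedReward β γ mStar - expectedReward β γ (m t))

end

end UCBRA

namespace UCBRA

/-! The width `w = t ^ (-η)` serves as a floor on the index of every thread. For `0 < β < 1` the
marginal reward is infinite at zero, so an allocation optimal for indices at least `w` cannot starve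
any thread: `m t i ^ (2 * β)` is at least of order `t ^ (-β)` (`IsPlay.le_rpow_two_mul`). Hence the
Gram weight `V` is at least `c * t ^ (1 - β) = c / w ^ 2`.

The estimation error is `M / V`, where `M` is a sum of weighted martingale noises. The potential `M
^ 2 / (1 + V)` is at most `log T` plus a mean-zero martingale (`sq_sum_div_one_add_sum_le`). By
AM-GM, `|M / V|` is at most `w` times an affine function of this potential
(`IsPlay.abs_estimate_sub_le`). The bound is linear in the martingale, so taking expectations
removes it, and no concentration inequality is needed.

By optimality of the play, the regret of a round is at most twice the total index error, which in
expectation is of order `w * (1 + log T)`. Summing `t ^ ((β - 1) / 2)` gives `T ^ ((1 + β) / 2)`.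
The prefactor depending on `N` and `β` is finally moved into `F` at the price of one more logarithm
(`mul_one_add_log_mul_rpow_le`). -/

/-- The (unregularized) Gram weight `∑ τ < t, m τ i ^ (2 * β)` of thread `i` before round `t`. -/
noncomputable def gram {N : ℕ} (β : ℝ) (m : ℕ → Fin N → ℝ) (t : ℕ) (i : Fin N) : ℝ :=
  ∑ τ ∈ Finset.Ico 1 t, m τ i ^ (2 * β)

/-- The weighted noise that round `τ` contributes to the estimate of thread `i`. -/
noncomputable def noise {N : ℕ} (β : ℝ) (γ : Fin N → ℝ) (m s : ℕ → Fin N → ℝ) (τ : ℕ)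
    (i : Fin N) : ℝ :=
  m τ i ^ β * (s τ i - γ i * m τ i ^ β)

/-- The martingale part of the squared self-normalized noise. -/
noncomputable def martingalePart {N : ℕ} (β : ℝ) (γ : Fin N → ℝ) (m s : ℕ → Fin N → ℝ) (t : ℕ)
    (i : Fin N) : ℝ :=
  ∑ τ ∈ Finset.Ico 1 t,
    2 * (∑ σ ∈ Finset.Ico 1 τ, noise β γ m s σ i) * noise β γ m s τ i / (1 + gram β m (τ + 1) i)

/-- A constant `c` such that `gram β m t i ≥ c * t ^ (1 - β)` for `t > N`. -/
noncomputable def gramConstant (N : ℕ) (β : ℝ) : ℝ :=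
  1 / 4 * (4 * (N : ℝ)) ^ (-(2 * β / (1 - β))) / (N + 1)

theorem gramConstant_pos {N : ℕ} (hN : 0 < N) (β : ℝ) : 0 < gramConstant N β := by
  unfold gramConstant
  have : (0 : ℝ) < N := by exact_mod_cast hN
  positivity

/-! ### Two real inequalities: a power sum and the self-normalized potential. -/

/-- By Bernoulli's inequality for exponents in `[0, 1]`, `T ^ p` grows by at least `p * T ^ (p - 1)`
in each step, and `2 * p ≥ 1`. -/
theorem sum_Icc_rpow_sub_one_le {p : ℝ} (hp : 1 / 2 ≤ p) (hp1 : p ≤ 1) (T : ℕ) :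
    ∑ t ∈ Finset.Icc 1 T, (t : ℝ) ^ (p - 1) ≤ 2 * (T : ℝ) ^ p := by
  induction T with
  | zero => simp; positivity
  | succ n ih =>
    rw [Finset.sum_Icc_succ_top (by omega)]
    have hT : (0 : ℝ) < ((n + 1 : ℕ) : ℝ) := by positivity
    have hn : (n : ℝ) = ((n + 1 : ℕ) : ℝ) * (1 + -(1 / ((n + 1 : ℕ) : ℝ))) := by
      field_simp; push_cast; ring
    have h1 : (1 : ℝ) / ((n + 1 : ℕ) : ℝ) ≤ 1 := by
      rw [div_le_one hT]; push_cast; linarith [(Nat.cast_nonneg n : (0 : ℝ) ≤ n)]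
    have hb := _root_.rpow_one_add_le_one_add_mul_self (s := -(1 / ((n + 1 : ℕ) : ℝ)))
      (by linarith) (p := p) (by linarith) hp1
    have h2 : (n : ℝ) ^ p ≤ ((n + 1 : ℕ) : ℝ) ^ p - p * ((n + 1 : ℕ) : ℝ) ^ (p - 1) := by
      conv_lhs => rw [hn]
      rw [Real.mul_rpow hT.le (by linarith), Real.rpow_sub_one hT.ne']
      calc _ ≤ ((n + 1 : ℕ) : ℝ) ^ p * (1 + p * -(1 / ((n + 1 : ℕ) : ℝ))) := by gcongr
        _ = _ := by ring
    have h3 : 0 ≤ ((n + 1 : ℕ) : ℝ) ^ (p - 1) := by positivity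
    nlinarith

/-- Expand the new square: the old square only loses when its denominator grows, the cross term is
the new summand, and the term in `x n ^ 2` is paid for by the increase of the logarithm. The
denominator of the summand at `τ` includes `v τ`; this stays predictable in the application, where
`v τ` depends on the allocation alone. -/
theorem sq_sum_div_one_add_sum_le (x v : ℕ → ℝ) (t : ℕ)
    (hxv : ∀ τ ∈ Finset.Ico 1 t, x τ ^ 2 ≤ v τ) :
    (∑ τ ∈ Finset.Ico 1 t, x τ) ^ 2 / (1 + ∑ τ ∈ Finset.Ico 1 t, v τ) ≤
      Real.log (1 + ∑ τ ∈ Finset.Ico 1 t, v τ) +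
        ∑ τ ∈ Finset.Ico 1 t,
          2 * (∑ σ ∈ Finset.Ico 1 τ, x σ) * x τ / (1 + ∑ σ ∈ Finset.Ico 1 (τ + 1), v σ) := by
  induction t with
  | zero => simp
  | succ n ih =>
    rcases Nat.eq_zero_or_pos n with rfl | hn
    · simp
    have hsub : ∀ τ ∈ Finset.Ico 1 n, x τ ^ 2 ≤ v τ := fun τ hτ => hxv τ (by simp at hτ ⊢; omega)
    specialize ih hsub
    have hV : 0 ≤ ∑ τ ∈ Finset.Ico 1 n, v τ :=
      Finset.sum_nonneg fun τ hτ => (sq_nonneg _).trans (hsub τ hτ)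
    have hx := hxv n (by simp; omega)
    rw [Finset.sum_Ico_succ_top hn, Finset.sum_Ico_succ_top hn,
      Finset.sum_Ico_succ_top hn (f := fun τ =>
        2 * (∑ σ ∈ Finset.Ico 1 τ, x σ) * x τ / (1 + ∑ σ ∈ Finset.Ico 1 (τ + 1), v σ)),
      Finset.sum_Ico_succ_top hn]
    set V := ∑ τ ∈ Finset.Ico 1 n, v τ
    set M := ∑ τ ∈ Finset.Ico 1 n, x τ
    have hv : 0 ≤ v n := (sq_nonneg _).trans hx
    have hpos : 0 < 1 + V := by linarith
    have hpos' : 0 < 1 + (V + v n) := by linarith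
    have h1 : M ^ 2 / (1 + (V + v n)) ≤ M ^ 2 / (1 + V) := by gcongr; linarith
    have h2 : x n ^ 2 / (1 + (V + v n)) ≤ Real.log (1 + (V + v n)) - Real.log (1 + V) := by
      rw [← Real.log_div hpos'.ne' hpos.ne']
      refine le_trans ?_ (Real.one_sub_inv_le_log_of_pos (by positivity))
      rw [inv_div, one_sub_div hpos'.ne']
      gcongr
      linarith
    have h3 : (M + x n) ^ 2 / (1 + (V + v n)) = M ^ 2 / (1 + (V + v n)) +
        2 * M * x n / (1 + (V + v n)) + x n ^ 2 / (1 + (V + v n)) := by ring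
    linarith

/-! ### Optimal allocations starve no thread: growth of the Gram weight. -/

theorem le_one_of_mem_allocations {N : ℕ} {m : Fin N → ℝ} (hm : m ∈ allocations N) (i : Fin N) :
    m i ≤ 1 :=
  (Finset.single_le_sum (fun j _ => hm.1 j) (Finset.mem_univ i)).trans hm.2

theorem rpow_mem_Icc_of_mem_allocations {N : ℕ} {m : Fin N → ℝ} (hm : m ∈ allocations N) {b : ℝ}
    (hb : 0 ≤ b) (i : Fin N) : m i ^ b ∈ Set.Icc (0 : ℝ) 1 :=
  ⟨Real.rpow_nonneg (hm.1 i) _,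
    Real.rpow_le_one (hm.1 i) (le_one_of_mem_allocations hm i) hb⟩

/-- Compare `m` with `(1 - h) * m` plus an extra `h` for thread `i`. Thread `i` then earns at least
`a i * h ^ β`, while each other thread loses at most `2 * h`. -/
theorem IsOptimalAllocation.half_rpow_le {N : ℕ} {β ε : ℝ} {a m : Fin N → ℝ} (hβ : 0 < β)
    (hβ1 : β < 1) (hε : 0 < ε) (hε1 : ε ≤ 1) (ha : ∀ i, ε ≤ a i) (ha2 : ∀ i, a i ≤ 2)
    (hm : IsOptimalAllocation β a m) (i : Fin N) :
    ((ε / (4 * N)) ^ (1 / (1 - β))) ^ β / 2 ≤ m i ^ β := by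
  have hN : (1 : ℝ) ≤ N := by exact_mod_cast Fin.pos i
  -- Chosen so that the total loss `2 * N * h` equals `ε * h ^ β / 2`, at most half of what thread
  -- `i` earns.
  set h : ℝ := (ε / (4 * N)) ^ (1 / (1 - β)) with hdef
  have hbase : 0 < ε / (4 * N) := by positivity
  have hh : 0 < h := by positivity
  have hh1 : h ≤ 1 := by
    refine Real.rpow_le_one hbase.le ?_ (by apply div_nonneg <;> linarith)
    rw [div_le_one (by positivity)]; linarith
  have hhβ : h ^ (1 - β) = ε / (4 * N) := by
    rw [hdef, ← Real.rpow_mul hbase.le, one_div_mul_cancel (by linarith), Real.rpow_one]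
  have hhm : 2 * N * h = ε * h ^ β / 2 := by
    have : h = h ^ (1 - β) * h ^ β := by rw [← Real.rpow_add hh]; simp
    conv_lhs => rw [this, hhβ]
    field_simp; ring
  have hmem := hm.1
  let m' : Fin N → ℝ := fun j => (1 - h) * m j + if j = i then h else 0
  have hm' : m' ∈ allocations N := by
    constructor
    · intro j
      have := mul_nonneg (sub_nonneg.2 hh1) (hmem.1 j)
      simp only [m']; split_ifs <;> linarith
    · simp only [m', Finset.sum_add_distrib, ← Finset.mul_sum, Finset.sum_ite_eq',
        Finset.mem_univ, if_true]
      nlinarith [hmem.2]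
  have hopt := hm.2 m' hm'
  unfold expectedReward at hopt
  rw [← Finset.add_sum_erase _ _ (Finset.mem_univ i),
    ← Finset.add_sum_erase _ (fun j => a j * m j ^ β) (Finset.mem_univ i)] at hopt
  have h1 : a i * h ^ β ≤ a i * m' i ^ β := by
    have : 0 ≤ a i := hε.le.trans (ha i)
    have := mul_nonneg (sub_nonneg.2 hh1) (hmem.1 i)
    gcongr
    simp only [m', if_true]; linarith
  have h2 : ∑ j ∈ Finset.univ.erase i, a j * m j ^ β - 2 * N * h ≤
      ∑ j ∈ Finset.univ.erase i, a j * m' j ^ β := by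
    have hcard : 2 * N * h ≥ ∑ j ∈ Finset.univ.erase i, 2 * h := by
      calc 2 * N * h = ∑ j : Fin N, 2 * h := by simp; ring
        _ ≥ _ := Finset.sum_le_sum_of_subset_of_nonneg (Finset.erase_subset _ _)
          fun _ _ _ => by positivity
    have : ∑ j ∈ Finset.univ.erase i, a j * m j ^ β - ∑ j ∈ Finset.univ.erase i, 2 * h ≤
        ∑ j ∈ Finset.univ.erase i, a j * m' j ^ β := by
      rw [← Finset.sum_sub_distrib]
      refine Finset.sum_le_sum fun j hj => ?_
      have hji := Finset.ne_of_mem_erase hj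
      have e : m' j = (1 - h) * m j := by simp [m', hji]
      have haj : 0 ≤ a j := hε.le.trans (ha j)
      have hmj := rpow_mem_Icc_of_mem_allocations hmem hβ.le j
      rw [e, Real.mul_rpow (by linarith) (hmem.1 j)]
      have h3 : 1 - h ≤ (1 - h) ^ β :=
        Real.self_le_rpow_of_le_one (by linarith) (by linarith) hβ1.le
      have h4 : a j * m j ^ β ≤ 2 := by nlinarith [ha2 j, hmj.1, hmj.2]
      have h5 : 0 ≤ a j * m j ^ β := mul_nonneg haj hmj.1
      nlinarith
    linarith
  have hai : 0 < a i := hε.trans_le (ha i)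
  have h6 : a i * (h ^ β / 2) ≤ a i * m i ^ β := by
    have : ε * (h ^ β / 2) ≤ a i * (h ^ β / 2) := by gcongr; exact ha i
    linarith
  exact le_of_mul_le_mul_left h6 hai

theorem confidenceWidth_pos (β : ℝ) {t : ℕ} (ht : 0 < t) : 0 < confidenceWidth β t :=
  Real.rpow_pos_of_pos (by exact_mod_cast ht) _

theorem confidenceWidth_le_one {β : ℝ} (hβ : β ≤ 1) {t : ℕ} (ht : 0 < t) :
    confidenceWidth β t ≤ 1 :=
  Real.rpow_le_one_of_one_le_of_nonpos (by exact_mod_cast ht) (by linarith)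

theorem IsPlay.mem_allocations {N : ℕ} {β : ℝ} {T : ℕ} {m s : ℕ → Fin N → ℝ}
    (h : IsPlay β T m s) {t : ℕ} (h1 : 1 ≤ t) (hT : t ≤ T) : m t ∈ allocations N := by
  by_cases hN : t ≤ N
  · have e := h.init t h1 hT hN
    refine ⟨fun i => by rw [e]; split_ifs <;> norm_num, ?_⟩
    have : ∀ i : Fin N, m t i = if i = (⟨t - 1, by omega⟩ : Fin N) then 1 else 0 := fun i => by
      rw [e]; congr 1; rw [Fin.ext_iff]; simp only [eq_iff_iff]; omega
    simp [this]
  · exact (h.step t (by omega) hT).1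

theorem estimate_nonneg {N : ℕ} {β : ℝ} {m s : ℕ → Fin N → ℝ} {t : ℕ} {i : Fin N}
    (hm : ∀ τ ∈ Finset.Ico 1 t, 0 ≤ m τ i) (hs : ∀ τ ∈ Finset.Ico 1 t, 0 ≤ s τ i) :
    0 ≤ estimate β m s t i :=
  div_nonneg
    (Finset.sum_nonneg fun τ hτ => mul_nonneg (Real.rpow_nonneg (hm τ hτ) _) (hs τ hτ))
    (Finset.sum_nonneg fun τ hτ => Real.rpow_nonneg (hm τ hτ) _)

theorem IsPlay.ucb_mem {N : ℕ} {β : ℝ} {T : ℕ} {m s : ℕ → Fin N → ℝ} (hβ : β ≤ 1)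
    (h : IsPlay β T m s) (hs : ∀ t, 1 ≤ t → t ≤ T → ∀ i, s t i ∈ Set.Icc (0 : ℝ) 1) {t : ℕ}
    (h1 : 1 ≤ t) (hT : t ≤ T) (i : Fin N) :
    ucb β m s t i ∈ Set.Icc (confidenceWidth β t) 2 := by
  have hest : 0 ≤ estimate β m s t i := by
    refine estimate_nonneg (fun τ hτ => ?_) (fun τ hτ => ?_) <;> rw [Finset.mem_Ico] at hτ
    · exact (h.mem_allocations hτ.1 (by omega)).1 i
    · exact (hs τ hτ.1 (by omega) i).1
  have := confidenceWidth_le_one hβ h1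
  have h2 := min_le_left 1 (estimate β m s t i)
  have h3 := le_min zero_le_one hest
  unfold ucb
  constructor <;> linarith

theorem IsPlay.le_rpow_two_mul {N : ℕ} {β : ℝ} {T : ℕ} {m s : ℕ → Fin N → ℝ} (hβ : 0 < β)
    (hβ1 : β < 1) (h : IsPlay β T m s)
    (hs : ∀ t, 1 ≤ t → t ≤ T → ∀ i, s t i ∈ Set.Icc (0 : ℝ) 1) {t : ℕ} (hN : N + 1 ≤ t)
    (hT : t ≤ T) (i : Fin N) :
    1 / 4 * (4 * (N : ℝ)) ^ (-(2 * β / (1 - β))) * (t : ℝ) ^ (-β) ≤ m t i ^ (2 * β) := by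
  have ht : 0 < t := by omega
  have ht' : (0 : ℝ) < t := by exact_mod_cast ht
  have hNpos : (0 : ℝ) < N := by exact_mod_cast Fin.pos i
  have hw := confidenceWidth_pos β ht
  have key := (h.step t hN hT).half_rpow_le hβ hβ1 hw (confidenceWidth_le_one hβ1.le ht)
    (fun j => (h.ucb_mem hβ1.le hs ht hT j).1) (fun j => (h.ucb_mem hβ1.le hs ht hT j).2) i
  have hmi := (h.mem_allocations ht hT).1 i
  have hbase : 0 < confidenceWidth β t / (4 * N) := by positivity
  have e1 : m t i ^ (2 * β) = (m t i ^ β) ^ 2 := by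
    rw [mul_comm, Real.rpow_mul hmi]; norm_cast
  have h1β : (1 - β) ≠ 0 := by linarith
  have e2 : (((confidenceWidth β t / (4 * N)) ^ (1 / (1 - β))) ^ β / 2) ^ 2 =
      1 / 4 * (4 * (N : ℝ)) ^ (-(2 * β / (1 - β))) * (t : ℝ) ^ (-β) := by
    rw [div_pow, ← Real.rpow_mul hbase.le, ← Real.rpow_natCast, ← Real.rpow_mul hbase.le,
      Real.div_rpow hw.le (by positivity), confidenceWidth, ← Real.rpow_mul ht'.le,
      Real.rpow_neg (by positivity)]
    -- The choice of `η` cancels the factor `1 - β` in the exponent.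
    have a1 : -((1 - β) / 2) * (1 / (1 - β) * β * ((2 : ℕ) : ℝ)) = -β := by
      push_cast; field_simp
    have a2 : 1 / (1 - β) * β * ((2 : ℕ) : ℝ) = 2 * β / (1 - β) := by
      push_cast; field_simp
    rw [a1, a2]
    ring
  rw [e1, ← e2]
  gcongr

theorem IsPlay.one_add_sum_le_gram {N : ℕ} {β : ℝ} {T : ℕ} {m s : ℕ → Fin N → ℝ}
    (h : IsPlay β T m s) {t : ℕ} (hN : N + 1 ≤ t) (hT : t ≤ T) (i : Fin N) :
    1 + ∑ τ ∈ Finset.Ico (N + 1) t, m τ i ^ (2 * β) ≤ gram β m t i := by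
  unfold gram
  rw [← Finset.sum_Ico_consecutive _ (Nat.le_add_left 1 N) hN]
  gcongr
  have hi := i.2
  have e : m ((i : ℕ) + 1) i ^ (2 * β) = 1 := by
    rw [h.init _ (by omega) (by omega) (by omega)]; simp
  rw [← e]
  refine Finset.single_le_sum (f := fun τ => m τ i ^ (2 * β)) (fun τ hτ => ?_) (by simp)
  rw [Finset.mem_Ico] at hτ
  exact Real.rpow_nonneg ((h.mem_allocations hτ.1 (by omega)).1 i) _

theorem IsPlay.one_le_gram {N : ℕ} {β : ℝ} {T : ℕ} {m s : ℕ → Fin N → ℝ}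
    (h : IsPlay β T m s) {t : ℕ} (hN : N + 1 ≤ t) (hT : t ≤ T) (i : Fin N) :
    1 ≤ gram β m t i := by
  refine le_trans ?_ (h.one_add_sum_le_gram hN hT i)
  have : 0 ≤ ∑ τ ∈ Finset.Ico (N + 1) t, m τ i ^ (2 * β) := Finset.sum_nonneg fun τ hτ => by
    rw [Finset.mem_Ico] at hτ
    exact Real.rpow_nonneg ((h.mem_allocations (by omega) (by omega)).1 i) _
  linarith

theorem IsPlay.gramConstant_mul_le {N : ℕ} {β : ℝ} {T : ℕ} {m s : ℕ → Fin N → ℝ} (hβ : 0 < β)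
    (hβ1 : β < 1) (h : IsPlay β T m s)
    (hs : ∀ t, 1 ≤ t → t ≤ T → ∀ i, s t i ∈ Set.Icc (0 : ℝ) 1) {t : ℕ} (hN : N + 1 ≤ t)
    (hT : t ≤ T) (i : Fin N) :
    gramConstant N β * (t : ℝ) ^ (1 - β) ≤ gram β m t i := by
  refine le_trans ?_ (h.one_add_sum_le_gram hN hT i)
  have hNpos : (1 : ℝ) ≤ N := by exact_mod_cast Fin.pos i
  have ht : (1 : ℝ) ≤ t := by exact_mod_cast (by omega : 1 ≤ t)
  have ht0 : (0 : ℝ) < t := by linarith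
  set a : ℝ := 1 / 4 * (4 * (N : ℝ)) ^ (-(2 * β / (1 - β))) with ha
  have ha0 : 0 ≤ a := by positivity
  have ha1 : a ≤ 1 := by
    have : (4 * (N : ℝ)) ^ (-(2 * β / (1 - β))) ≤ 1 := by
      refine Real.rpow_le_one_of_one_le_of_nonpos (by linarith) ?_
      have : 0 ≤ 2 * β / (1 - β) := div_nonneg (by linarith) (by linarith)
      linarith
    rw [ha]; linarith
  have hw0 : 0 ≤ (t : ℝ) ^ (-β) := by positivity
  have hw1 : (t : ℝ) ^ (-β) ≤ 1 := Real.rpow_le_one_of_one_le_of_nonpos ht (by linarith)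
  have hsum : ((t : ℝ) - (N + 1)) * (a * (t : ℝ) ^ (-β)) ≤
      ∑ τ ∈ Finset.Ico (N + 1) t, m τ i ^ (2 * β) := by
    have : ∑ τ ∈ Finset.Ico (N + 1) t, a * (t : ℝ) ^ (-β) ≤
        ∑ τ ∈ Finset.Ico (N + 1) t, m τ i ^ (2 * β) := by
      refine Finset.sum_le_sum fun τ hτ => ?_
      rw [Finset.mem_Ico] at hτ
      refine le_trans ?_ (h.le_rpow_two_mul hβ hβ1 hs hτ.1 (by omega) i)
      have hτ0 : (0 : ℝ) < τ := by exact_mod_cast (by omega : 0 < τ)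
      have hτt : (τ : ℝ) ≤ t := by exact_mod_cast hτ.2.le
      gcongr ?_ * ?_
      exact Real.rpow_le_rpow_of_nonpos hτ0 hτt (by linarith)
    rwa [Finset.sum_const, Nat.card_Ico, nsmul_eq_mul, Nat.cast_sub hN, Nat.cast_add,
      Nat.cast_one] at this
  have e : (t : ℝ) ^ (1 - β) = t * (t : ℝ) ^ (-β) := by
    rw [sub_eq_add_neg, Real.rpow_add ht0, Real.rpow_one]
  have e2 : gramConstant N β = a / (N + 1) := rfl
  rw [e, e2]
  set w := (t : ℝ) ^ (-β)
  have hNt : (N : ℝ) + 1 ≤ t := by exact_mod_cast hN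
  have haw0 : 0 ≤ a * w := mul_nonneg ha0 hw0
  have haw : a * w ≤ 1 := by nlinarith
  have : a / (N + 1) * (t * w) = (a * w) * (t / (N + 1)) := by ring
  rw [this]
  -- The unit of weight from the initial rounds keeps the bound valid down to `t = N + 1`; this is
  -- why `gramConstant` contains the factor `1 / (N + 1)`.
  have h3 : (t : ℝ) / (N + 1) ≤ 1 + (t - (N + 1)) := by
    rw [div_le_iff₀ (by linarith)]; nlinarith
  calc a * w * (t / (N + 1)) ≤ a * w * (1 + (t - (N + 1))) := by gcongr
    _ ≤ 1 + (t - (N + 1)) * (a * w) := by linarith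
    _ ≤ _ := by linarith

/-! ### Pathwise estimation error and regret of one round. -/

theorem estimate_sub_eq {N : ℕ} {β : ℝ} {γ : Fin N → ℝ} {m s : ℕ → Fin N → ℝ} {t : ℕ} {i : Fin N}
    (hm : ∀ τ ∈ Finset.Ico 1 t, 0 ≤ m τ i) (hg : gram β m t i ≠ 0) :
    estimate β m s t i - γ i = (∑ τ ∈ Finset.Ico 1 t, noise β γ m s τ i) / gram β m t i := by
  have e : ∑ τ ∈ Finset.Ico 1 t, noise β γ m s τ i =
      ∑ τ ∈ Finset.Ico 1 t, m τ i ^ β * s τ i - γ i * gram β m t i := by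
    unfold noise gram
    rw [Finset.mul_sum, ← Finset.sum_sub_distrib]
    refine Finset.sum_congr rfl fun τ hτ => ?_
    rw [mul_comm 2 β, Real.rpow_mul (hm τ hτ)]
    norm_cast
    ring
  rw [e, sub_div, mul_div_cancel_right₀ _ hg]
  rfl

/-- Clipping at 1 cannot move the estimate away from a target `x ≤ 1`. -/
theorem abs_ucb_sub_le {N : ℕ} {β : ℝ} {m s : ℕ → Fin N → ℝ} {t : ℕ} {i : Fin N} {x : ℝ}
    (hx : x ≤ 1) (ht : 0 < t) :
    |ucb β m s t i - x| ≤ |estimate β m s t i - x| + confidenceWidth β t := by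
  have h1 : |min 1 (estimate β m s t i) - x| ≤ |estimate β m s t i - x| := by
    rcases le_total 1 (estimate β m s t i) with h | h
    · rw [min_eq_left h, abs_of_nonneg (by linarith), abs_of_nonneg (by linarith)]; linarith
    · rw [min_eq_right h]
  have e : ucb β m s t i - x = (min 1 (estimate β m s t i) - x) + confidenceWidth β t := by
    unfold ucb; ring
  rw [e]
  refine (abs_add_le _ _).trans ?_
  rw [abs_of_pos (confidenceWidth_pos β ht)]
  linarith

theorem abs_expectedReward_sub_le {N : ℕ} {β : ℝ} (hβ : 0 ≤ β) {a b m : Fin N → ℝ}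
    (hm : m ∈ allocations N) :
    |expectedReward β a m - expectedReward β b m| ≤ ∑ i, |a i - b i| := by
  unfold expectedReward
  rw [← Finset.sum_sub_distrib]
  refine (Finset.abs_sum_le_sum_abs _ _).trans (Finset.sum_le_sum fun i _ => ?_)
  have := rpow_mem_Icc_of_mem_allocations hm hβ i
  rw [← sub_mul, abs_mul, abs_of_nonneg this.1]
  exact mul_le_of_le_one_right (abs_nonneg _) this.2

theorem IsOptimalAllocation.expectedReward_sub_le {N : ℕ} {β : ℝ} (hβ : 0 ≤ β)
    {a γ m m' : Fin N → ℝ} (hm : IsOptimalAllocation β a m) (hm' : m' ∈ allocations N) :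
    expectedReward β γ m' - expectedReward β γ m ≤ 2 * ∑ i, |a i - γ i| := by
  have h1 := (abs_le.1 (abs_expectedReward_sub_le hβ (a := a) (b := γ) hm')).1
  have h2 := (abs_le.1 (abs_expectedReward_sub_le hβ (a := a) (b := γ) hm.1)).2
  have h3 := hm.2 m' hm'
  linarith

theorem expectedReward_mem_Icc {N : ℕ} {β : ℝ} (hβ : 0 ≤ β) {γ m : Fin N → ℝ}
    (hγ : ∀ i, γ i ∈ Set.Icc (0 : ℝ) 1) (hm : m ∈ allocations N) :
    expectedReward β γ m ∈ Set.Icc (0 : ℝ) N := by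
  have h := rpow_mem_Icc_of_mem_allocations hm hβ
  refine ⟨Finset.sum_nonneg fun i _ => mul_nonneg (hγ i).1 (h i).1, ?_⟩
  calc ∑ i, γ i * m i ^ β ≤ ∑ _i : Fin N, (1 : ℝ) :=
        Finset.sum_le_sum fun i _ => mul_le_one₀ (hγ i).2 (h i).1 (h i).2
    _ = N := by simp

theorem IsPlay.gram_le {N : ℕ} {β : ℝ} {T : ℕ} {m s : ℕ → Fin N → ℝ} (hβ : 0 ≤ β)
    (h : IsPlay β T m s) {t : ℕ} (h1 : 1 ≤ t) (hT : t ≤ T) (i : Fin N) :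
    1 + gram β m t i ≤ t := by
  have : gram β m t i ≤ ∑ τ ∈ Finset.Ico 1 t, (1 : ℝ) := Finset.sum_le_sum fun τ hτ => by
    rw [Finset.mem_Ico] at hτ
    exact (rpow_mem_Icc_of_mem_allocations (h.mem_allocations hτ.1 (by omega))
      (by linarith : 0 ≤ 2 * β) i).2
  simp only [Finset.sum_const, Nat.card_Ico, nsmul_eq_mul, Nat.cast_sub h1, Nat.cast_one,
    mul_one] at this
  linarith

theorem IsPlay.abs_sub_le_one {N : ℕ} {β : ℝ} {T : ℕ} {γ : Fin N → ℝ} {m s : ℕ → Fin N → ℝ}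
    (hβ : 0 ≤ β) (hγ : ∀ i, γ i ∈ Set.Icc (0 : ℝ) 1) (h : IsPlay β T m s)
    (hs : ∀ t, 1 ≤ t → t ≤ T → ∀ i, s t i ∈ Set.Icc (0 : ℝ) 1) {t : ℕ} (h1 : 1 ≤ t)
    (hT : t ≤ T) (i : Fin N) : |s t i - γ i * m t i ^ β| ≤ 1 := by
  have a := rpow_mem_Icc_of_mem_allocations (h.mem_allocations h1 hT) hβ i
  have b := hs t h1 hT i
  have c := mul_nonneg (hγ i).1 a.1
  have d := mul_le_one₀ (hγ i).2 a.1 a.2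
  rw [abs_le]
  constructor <;> linarith [b.1, b.2]

theorem IsPlay.noise_sq_le {N : ℕ} {β : ℝ} {T : ℕ} {γ : Fin N → ℝ} {m s : ℕ → Fin N → ℝ}
    (hβ : 0 ≤ β) (hγ : ∀ i, γ i ∈ Set.Icc (0 : ℝ) 1) (h : IsPlay β T m s)
    (hs : ∀ t, 1 ≤ t → t ≤ T → ∀ i, s t i ∈ Set.Icc (0 : ℝ) 1) {t : ℕ} (h1 : 1 ≤ t)
    (hT : t ≤ T) (i : Fin N) : noise β γ m s t i ^ 2 ≤ m t i ^ (2 * β) := by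
  have a := (h.mem_allocations h1 hT).1 i
  have e : m t i ^ (2 * β) = (m t i ^ β) ^ 2 := by
    rw [mul_comm, Real.rpow_mul a]; norm_cast
  rw [noise, mul_pow, e]
  refine mul_le_of_le_one_right (sq_nonneg _) ?_
  rw [sq_le_one_iff_abs_le_one]
  exact h.abs_sub_le_one hβ hγ hs h1 hT i

theorem IsPlay.abs_estimate_sub_le {N : ℕ} {β : ℝ} {T : ℕ} {γ : Fin N → ℝ}
    {m s : ℕ → Fin N → ℝ} (hβ : 0 < β) (hβ1 : β < 1) (hγ : ∀ i, γ i ∈ Set.Icc (0 : ℝ) 1)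
    (h : IsPlay β T m s) (hs : ∀ t, 1 ≤ t → t ≤ T → ∀ i, s t i ∈ Set.Icc (0 : ℝ) 1) {t : ℕ}
    (hN : N + 1 ≤ t) (hT : t ≤ T) (i : Fin N) :
    |estimate β m s t i - γ i| ≤ confidenceWidth β t *
      ((Real.log T + martingalePart β γ m s t i) / gramConstant N β + 1 / 2) := by
  have hc := gramConstant_pos (Fin.pos i) β
  have hV1 := h.one_le_gram hN hT i
  have hVc := h.gramConstant_mul_le hβ hβ1 hs hN hT i
  have ht0 : (0 : ℝ) < t := by exact_mod_cast (by omega : 0 < t)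
  have hVt := h.gram_le hβ.le (by omega) hT i
  have hpot := sq_sum_div_one_add_sum_le (fun τ => noise β γ m s τ i)
    (fun τ => m τ i ^ (2 * β)) t (fun τ hτ => by
      rw [Finset.mem_Ico] at hτ
      exact h.noise_sq_le hβ.le hγ hs hτ.1 (by omega) i)
  change _ / (1 + gram β m t i) ≤ Real.log (1 + gram β m t i) + martingalePart β γ m s t i at hpot
  rw [estimate_sub_eq (fun τ hτ => by
    rw [Finset.mem_Ico] at hτ
    exact (h.mem_allocations hτ.1 (by omega)).1 i) (by linarith : gram β m t i ≠ 0)]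
  have hlog : Real.log (1 + gram β m t i) ≤ Real.log T :=
    Real.log_le_log (by linarith) (hVt.trans (by exact_mod_cast hT))
  have hw := confidenceWidth_pos β (t := t) (by omega)
  have hw2 : (t : ℝ) ^ (1 - β) * confidenceWidth β t ^ 2 = 1 := by
    rw [confidenceWidth, ← Real.rpow_natCast, ← Real.rpow_mul ht0.le, ← Real.rpow_add ht0]
    ring_nf
    simp
  set w := confidenceWidth β t
  set V := gram β m t i
  set M := ∑ τ ∈ Finset.Ico 1 t, noise β γ m s τ i
  set c := gramConstant N β
  set L := Real.log T + martingalePart β γ m s t i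
  have hΦ : M ^ 2 / (1 + V) ≤ L := by linarith
  have hwV : c ≤ V * w ^ 2 := by
    calc c = c * (t : ℝ) ^ (1 - β) * w ^ 2 := by rw [mul_assoc, hw2, mul_one]
      _ ≤ V * w ^ 2 := by gcongr
  have hV0 : 0 < V := by linarith
  -- One factor `1 / V` is at most `2 / (1 + V)` because `V ≥ 1`; the other is at most `w ^ 2 / c`.
  have h1 : (M / V) ^ 2 ≤ w ^ 2 * (2 * (M ^ 2 / (1 + V)) / c) := by
    have e : w ^ 2 * (2 * (M ^ 2 / (1 + V)) / c) = (2 * M ^ 2 * w ^ 2) / ((1 + V) * c) := by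
      field_simp
    rw [div_pow, e, div_le_div_iff₀ (by positivity) (by positivity)]
    have h2 : (1 + V) * c ≤ (2 * V) * (V * w ^ 2) := by gcongr; linarith
    nlinarith [sq_nonneg M]
  have h2 : |M / V| ≤ w * (M ^ 2 / (1 + V) / c + 1 / 2) := by
    have hx : 0 ≤ M ^ 2 / (1 + V) / c := by positivity
    refine abs_le_of_sq_le_sq (h1.trans ?_) (by positivity)
    rw [mul_pow]
    gcongr
    rw [mul_div_assoc]
    -- AM-GM as `2 * x ≤ (x + 1 / 2) ^ 2`; it replaces a square root by a bound linear in the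
    -- potential.
    nlinarith [sq_nonneg (M ^ 2 / (1 + V) / c - 1 / 2)]
  refine h2.trans ?_
  gcongr

theorem IsPlay.round_regret_le {N : ℕ} {β : ℝ} {T : ℕ} {γ mStar : Fin N → ℝ}
    {m s : ℕ → Fin N → ℝ} (hβ : 0 < β) (hβ1 : β < 1) (hγ : ∀ i, γ i ∈ Set.Icc (0 : ℝ) 1)
    (hStar : mStar ∈ allocations N) (h : IsPlay β T m s)
    (hs : ∀ t, 1 ≤ t → t ≤ T → ∀ i, s t i ∈ Set.Icc (0 : ℝ) 1) {t : ℕ}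
    (hN : N + 1 ≤ t) (hT : t ≤ T) :
    expectedReward β γ mStar - expectedReward β γ (m t) ≤
      2 * ∑ i, confidenceWidth β t *
        ((Real.log T + martingalePart β γ m s t i) / gramConstant N β + 3 / 2) := by
  refine ((h.step t hN hT).expectedReward_sub_le hβ.le hStar).trans ?_
  gcongr with i
  have h1 := abs_ucb_sub_le (β := β) (m := m) (s := s) (i := i) (hγ i).2 (by omega : 0 < t)
  have h2 := h.abs_estimate_sub_le hβ hβ1 hγ hs hN hT i
  linarith

/-! ### Expectations: the martingale part integrates to zero. -/

theorem integral_mul_sub_eq_zero_of_condExp_eq {Ω : Type*} {𝒢 mΩ : MeasurableSpace Ω}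
    {μ : Measure Ω} [IsFiniteMeasure μ] (h𝒢 : 𝒢 ≤ mΩ) {f g h : Ω → ℝ}
    (hf : StronglyMeasurable[𝒢] f) {c : ℝ} (hfc : ∀ ω, |f ω| ≤ c) (hg : Integrable g μ)
    (hgh : μ[g | 𝒢] =ᵐ[μ] h) :
    Integrable (fun ω => f ω * (g ω - h ω)) μ ∧ ∫ ω, f ω * (g ω - h ω) ∂μ = 0 := by
  have hh : Integrable h μ := integrable_condExp.congr hgh
  have hf' : AEStronglyMeasurable f μ := (hf.mono h𝒢).aestronglyMeasurable
  have hb : ∀ᵐ ω ∂μ, ‖f ω‖ ≤ c := Filter.Eventually.of_forall hfc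
  have hfg : Integrable (fun ω => f ω * g ω) μ := hg.bdd_mul hf' hb
  have hfh : Integrable (fun ω => f ω * h ω) μ := hh.bdd_mul hf' hb
  simp_rw [mul_sub]
  refine ⟨hfg.sub hfh, ?_⟩
  rw [integral_sub hfg hfh, sub_eq_zero, ← integral_condExp h𝒢]
  refine integral_congr_ae ?_
  filter_upwards [condExp_stronglyMeasurable_mul_of_bound h𝒢 hf hg c hb, hgh] with ω h1 h2
  rw [← h2]
  exact h1

section

variable {N : ℕ} {β : ℝ} {γ : Fin N → ℝ} {T : ℕ} {Ω : Type*} {mΩ : MeasurableSpace Ω}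
  {μ : Measure Ω} {ℱ : Filtration ℕ mΩ} {m s : ℕ → Ω → Fin N → ℝ}

theorem IsRewardModel.reward_mem_Icc (hM : IsRewardModel μ ℱ β γ T m s) (ω : Ω) (t : ℕ)
    (h1 : 1 ≤ t) (hT : t ≤ T) (i : Fin N) : s t ω i ∈ Set.Icc (0 : ℝ) 1 := by
  obtain ⟨u, rfl⟩ := Nat.exists_eq_add_of_le' h1
  exact hM.reward_mem u hT i ω

theorem IsRewardModel.measurable_noise (hM : IsRewardModel μ ℱ β γ T m s) {t : ℕ}
    (h1 : 1 ≤ t) (hT : t ≤ T) (i : Fin N) :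
    Measurable[ℱ t] (fun ω => noise β γ (fun t => m t ω) (fun t => s t ω) t i) := by
  obtain ⟨u, rfl⟩ := Nat.exists_eq_add_of_le' h1
  have ha : Measurable[ℱ (u + 1)] (fun ω => m (u + 1) ω i ^ β) :=
    ((hM.allocation_measurable u hT i).mono (ℱ.mono (Nat.le_succ u)) le_rfl).pow_const β
  have hb := hM.reward_measurable u hT i
  exact ha.mul (hb.sub (ha.const_mul (γ i)))

theorem IsRewardModel.measurable_gram (hM : IsRewardModel μ ℱ β γ T m s) {t : ℕ} (hT : t < T)
    (i : Fin N) : Measurable[ℱ t] (fun ω => gram β (fun t => m t ω) (t + 1 + 1) i) := by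
  unfold gram
  refine Finset.measurable_fun_sum _ fun τ hτ => ?_
  rw [Finset.mem_Ico] at hτ
  obtain ⟨u, rfl⟩ := Nat.exists_eq_add_of_le' hτ.1
  exact ((hM.allocation_measurable u (by omega) i).mono (ℱ.mono (by omega)) le_rfl).pow_const _

theorem IsRewardModel.integral_martingale_increment [IsProbabilityMeasure μ] (hβ : 0 ≤ β)
    (hγ : ∀ i, γ i ∈ Set.Icc (0 : ℝ) 1) (hM : IsRewardModel μ ℱ β γ T m s)
    (hP : ∀ ω, IsPlay β T (fun t => m t ω) (fun t => s t ω)) {t : ℕ} (hT : t < T) (i : Fin N) :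
    Integrable (fun ω => 2 * (∑ σ ∈ Finset.Ico 1 (t + 1),
        noise β γ (fun t => m t ω) (fun t => s t ω) σ i) *
        noise β γ (fun t => m t ω) (fun t => s t ω) (t + 1) i /
        (1 + gram β (fun t => m t ω) (t + 1 + 1) i)) μ ∧
      ∫ ω, 2 * (∑ σ ∈ Finset.Ico 1 (t + 1),
        noise β γ (fun t => m t ω) (fun t => s t ω) σ i) *
        noise β γ (fun t => m t ω) (fun t => s t ω) (t + 1) i /
        (1 + gram β (fun t => m t ω) (t + 1 + 1) i) ∂μ = 0 := by
  have hmem : ∀ ω τ, 1 ≤ τ → τ ≤ T → m τ ω i ^ (2 * β) ∈ Set.Icc (0 : ℝ) 1 := fun ω τ h1 h2 =>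
    rpow_mem_Icc_of_mem_allocations ((hP ω).mem_allocations h1 h2) (by linarith) i
  have hsum : Measurable[ℱ t] (fun ω => ∑ σ ∈ Finset.Ico 1 (t + 1),
      noise β γ (fun t => m t ω) (fun t => s t ω) σ i) := by
    refine Finset.measurable_fun_sum _ fun σ hσ => ?_
    rw [Finset.mem_Ico] at hσ
    exact (hM.measurable_noise hσ.1 (by omega) i).mono (ℱ.mono (by omega)) le_rfl
  have ha : Measurable[ℱ t] (fun ω => m (t + 1) ω i ^ β) :=
    (hM.allocation_measurable t hT i).pow_const β
  -- The increment without its centred reward. The Gram weight at `t + 1 + 1` involves only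
  -- allocations up to round `t + 1`, so `f` is known at time `t`.
  let f : Ω → ℝ := fun ω => 2 * (∑ σ ∈ Finset.Ico 1 (t + 1),
    noise β γ (fun t => m t ω) (fun t => s t ω) σ i) * m (t + 1) ω i ^ β /
    (1 + gram β (fun t => m t ω) (t + 1 + 1) i)
  have hf : Measurable[ℱ t] f :=
    ((hsum.const_mul 2).mul ha).div ((hM.measurable_gram hT i).const_add 1)
  have hfc : ∀ ω, |f ω| ≤ 2 * t := fun ω => by
    have hg : 0 ≤ gram β (fun t => m t ω) (t + 1 + 1) i := Finset.sum_nonneg fun τ hτ => by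
      rw [Finset.mem_Ico] at hτ
      exact (hmem ω τ hτ.1 (by omega)).1
    have hn : |∑ σ ∈ Finset.Ico 1 (t + 1),
        noise β γ (fun t => m t ω) (fun t => s t ω) σ i| ≤ t := by
      refine (Finset.abs_sum_le_sum_abs _ _).trans ?_
      calc _ ≤ ∑ σ ∈ Finset.Ico 1 (t + 1), (1 : ℝ) := Finset.sum_le_sum fun σ hσ => by
            rw [Finset.mem_Ico] at hσ
            rw [← sq_le_one_iff_abs_le_one]
            exact ((hP ω).noise_sq_le hβ hγ (hM.reward_mem_Icc ω) hσ.1 (by omega) i).trans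
              (hmem ω σ hσ.1 (by omega)).2
        _ = t := by simp
    have hm := rpow_mem_Icc_of_mem_allocations
      ((hP ω).mem_allocations (Nat.le_add_left 1 t) hT) hβ i
    have hd : 0 < 1 + gram β (fun t => m t ω) (t + 1 + 1) i := by linarith
    simp only [f]
    rw [abs_div, abs_mul, abs_mul, abs_two, abs_of_nonneg hm.1, abs_of_pos hd]
    refine (div_le_self (by have := hm.1; positivity) (by linarith)).trans ?_
    refine (mul_le_of_le_one_right (by positivity) hm.2).trans ?_
    gcongr
  have hs : Integrable (fun ω => s (t + 1) ω i) μ :=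
    Integrable.of_bound
      ((hM.reward_measurable t hT i).mono (ℱ.le _) le_rfl).aestronglyMeasurable 1
      (Filter.Eventually.of_forall fun ω => by
        have := hM.reward_mem t hT i ω
        rw [Real.norm_eq_abs, abs_of_nonneg this.1]; exact this.2)
  have key := integral_mul_sub_eq_zero_of_condExp_eq (ℱ.le t) hf.stronglyMeasurable hfc hs
    (hM.reward_mean t hT i)
  have e : ∀ ω, 2 * (∑ σ ∈ Finset.Ico 1 (t + 1),
      noise β γ (fun t => m t ω) (fun t => s t ω) σ i) *
      noise β γ (fun t => m t ω) (fun t => s t ω) (t + 1) i /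
      (1 + gram β (fun t => m t ω) (t + 1 + 1) i) =
      f ω * (s (t + 1) ω i - γ i * m (t + 1) ω i ^ β) := fun ω => by
    have : noise β γ (fun t => m t ω) (fun t => s t ω) (t + 1) i =
      m (t + 1) ω i ^ β * (s (t + 1) ω i - γ i * m (t + 1) ω i ^ β) := rfl
    simp only [f, this]; ring
  simp_rw [e]
  exact key

theorem IsRewardModel.integral_martingalePart [IsProbabilityMeasure μ] (hβ : 0 ≤ β)
    (hγ : ∀ i, γ i ∈ Set.Icc (0 : ℝ) 1) (hM : IsRewardModel μ ℱ β γ T m s)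
    (hP : ∀ ω, IsPlay β T (fun t => m t ω) (fun t => s t ω)) {t : ℕ} (hT : t ≤ T) (i : Fin N) :
    Integrable (fun ω => martingalePart β γ (fun t => m t ω) (fun t => s t ω) t i) μ ∧
      ∫ ω, martingalePart β γ (fun t => m t ω) (fun t => s t ω) t i ∂μ = 0 := by
  unfold martingalePart
  have key := fun τ (hτ : τ ∈ Finset.Ico 1 t) => by
    have hτ' := Finset.mem_Ico.1 hτ
    have := hM.integral_martingale_increment hβ hγ hP (t := τ - 1) (by omega) i
    rwa [Nat.sub_add_cancel hτ'.1] at this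
  refine ⟨integrable_finsetSum _ fun τ hτ => (key τ hτ).1, ?_⟩
  rw [integral_finsetSum _ fun τ hτ => (key τ hτ).1]
  exact Finset.sum_eq_zero fun τ hτ => (key τ hτ).2

theorem IsRewardModel.integrable_round_regret [IsProbabilityMeasure μ] (hβ : 0 ≤ β)
    (hγ : ∀ i, γ i ∈ Set.Icc (0 : ℝ) 1) {mStar : Fin N → ℝ}
    (hM : IsRewardModel μ ℱ β γ T m s)
    (hP : ∀ ω, IsPlay β T (fun t => m t ω) (fun t => s t ω)) {t : ℕ} (h1 : 1 ≤ t) (hT : t ≤ T) :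
    Integrable (fun ω => expectedReward β γ mStar - expectedReward β γ (m t ω)) μ := by
  refine (integrable_const _).sub (Integrable.of_bound ?_ (N : ℝ)
    (Filter.Eventually.of_forall fun ω => ?_))
  · obtain ⟨u, rfl⟩ := Nat.exists_eq_add_of_le' h1
    unfold expectedReward
    refine (Finset.measurable_fun_sum _ fun i _ => ?_).aestronglyMeasurable
    exact (((hM.allocation_measurable u hT i).mono (ℱ.le u) le_rfl).pow_const β).const_mul _
  · have := expectedReward_mem_Icc hβ hγ ((hP ω).mem_allocations h1 hT)
    rw [Real.norm_eq_abs, abs_of_nonneg this.1]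
    exact this.2

theorem IsRewardModel.integral_round_regret_le [IsProbabilityMeasure μ] (hβ : 0 < β)
    (hβ1 : β < 1) (hγ : ∀ i, γ i ∈ Set.Icc (0 : ℝ) 1) {mStar : Fin N → ℝ}
    (hStar : mStar ∈ allocations N) (hM : IsRewardModel μ ℱ β γ T m s)
    (hP : ∀ ω, IsPlay β T (fun t => m t ω) (fun t => s t ω)) {t : ℕ} (hN : N + 1 ≤ t)
    (hT : t ≤ T) :
    ∫ ω, (expectedReward β γ mStar - expectedReward β γ (m t ω)) ∂μ ≤
      2 * (N * (confidenceWidth β t * (Real.log T / gramConstant N β + 3 / 2))) := by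
  have hmart := fun i => hM.integral_martingalePart hβ.le hγ hP hT i
  have hint : ∀ i, Integrable (fun ω => confidenceWidth β t * ((Real.log T +
      martingalePart β γ (fun t => m t ω) (fun t => s t ω) t i) / gramConstant N β + 3 / 2)) μ :=
    fun i => (((((integrable_const _).add (hmart i).1).div_const _).add
      (integrable_const _)).const_mul _)
  calc _ ≤ ∫ ω, 2 * ∑ i, confidenceWidth β t * ((Real.log T +
          martingalePart β γ (fun t => m t ω) (fun t => s t ω) t i) / gramConstant N β +
            3 / 2) ∂μ := by
        refine integral_mono (hM.integrable_round_regret hβ.le hγ hP (by omega) hT)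
          ((integrable_finsetSum _ fun i _ => hint i).const_mul 2) fun ω => ?_
        exact (hP ω).round_regret_le hβ hβ1 hγ hStar (hM.reward_mem_Icc ω) hN hT
    _ = _ := by
        rw [integral_const_mul, integral_finsetSum _ fun i _ => hint i]
        have : ∀ i, ∫ ω, confidenceWidth β t * ((Real.log T +
            martingalePart β γ (fun t => m t ω) (fun t => s t ω) t i) / gramConstant N β +
              3 / 2) ∂μ = confidenceWidth β t * (Real.log T / gramConstant N β + 3 / 2) := by
          intro i
          have h1 : Integrable (fun ω => Real.log T +
            martingalePart β γ (fun t => m t ω) (fun t => s t ω) t i) μ :=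
            (integrable_const _).add (hmart i).1
          rw [integral_const_mul, integral_add (h1.div_const _) (integrable_const _),
            integral_div, integral_add (integrable_const _) (hmart i).1, (hmart i).2]
          simp
        simp [this]

/-! ### Summation over the rounds. -/

/-- The constant, depending on `N` and `β`, in the leading term of the regret bound. -/
noncomputable def regretConstant (N : ℕ) (β : ℝ) : ℝ :=
  4 * N * (1 / gramConstant N β + 3 / 2)

theorem regretConstant_nonneg (N : ℕ) (β : ℝ) : 0 ≤ regretConstant N β := by
  unfold regretConstant gramConstant
  positivity

theorem natCast_le_regretConstant (N : ℕ) (β : ℝ) : (N : ℝ) ≤ regretConstant N β := by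
  have : 0 ≤ 1 / gramConstant N β := by unfold gramConstant; positivity
  have hN : (0 : ℝ) ≤ N := Nat.cast_nonneg N
  unfold regretConstant
  nlinarith [mul_nonneg hN this]

theorem IsRewardModel.integrable_regret [IsProbabilityMeasure μ] (hβ : 0 ≤ β)
    (hγ : ∀ i, γ i ∈ Set.Icc (0 : ℝ) 1) {mStar : Fin N → ℝ}
    (hM : IsRewardModel μ ℱ β γ T m s)
    (hP : ∀ ω, IsPlay β T (fun t => m t ω) (fun t => s t ω)) :
    Integrable (fun ω => regret β γ mStar T (fun t => m t ω)) μ := by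
  unfold regret
  refine integrable_finsetSum _ fun t ht => ?_
  rw [Finset.mem_Icc] at ht
  exact hM.integrable_round_regret hβ hγ hP ht.1 ht.2

theorem round_regret_le_card {mStar : Fin N → ℝ} (hβ : 0 ≤ β)
    (hγ : ∀ i, γ i ∈ Set.Icc (0 : ℝ) 1) (hStar : mStar ∈ allocations N) {a : Fin N → ℝ}
    (ha : a ∈ allocations N) : expectedReward β γ mStar - expectedReward β γ a ≤ N := by
  have h1 := expectedReward_mem_Icc hβ hγ hStar
  have h2 := expectedReward_mem_Icc hβ hγ ha
  linarith [h1.2, h2.1]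

theorem IsRewardModel.integral_round_regret_le_card [IsProbabilityMeasure μ] (hβ : 0 ≤ β)
    (hγ : ∀ i, γ i ∈ Set.Icc (0 : ℝ) 1) {mStar : Fin N → ℝ}
    (hStar : mStar ∈ allocations N) (hM : IsRewardModel μ ℱ β γ T m s)
    (hP : ∀ ω, IsPlay β T (fun t => m t ω) (fun t => s t ω)) {t : ℕ} (h1 : 1 ≤ t) (hT : t ≤ T) :
    ∫ ω, (expectedReward β γ mStar - expectedReward β γ (m t ω)) ∂μ ≤ N := by
  refine (integral_mono (hM.integrable_round_regret hβ hγ hP h1 hT) (integrable_const (N : ℝ))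
    fun ω => round_regret_le_card hβ hγ hStar ((hP ω).mem_allocations h1 hT)).trans ?_
  simp

theorem IsRewardModel.integral_regret_eq [IsProbabilityMeasure μ] (hβ : 0 ≤ β)
    (hγ : ∀ i, γ i ∈ Set.Icc (0 : ℝ) 1) {mStar : Fin N → ℝ}
    (hM : IsRewardModel μ ℱ β γ T m s)
    (hP : ∀ ω, IsPlay β T (fun t => m t ω) (fun t => s t ω)) :
    ∫ ω, regret β γ mStar T (fun t => m t ω) ∂μ = ∑ t ∈ Finset.Icc 1 T,
      ∫ ω, (expectedReward β γ mStar - expectedReward β γ (m t ω)) ∂μ := by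
  unfold regret
  refine integral_finsetSum _ fun t ht => ?_
  rw [Finset.mem_Icc] at ht
  exact hM.integrable_round_regret hβ hγ hP ht.1 ht.2

theorem IsRewardModel.integral_regret_le [IsProbabilityMeasure μ] (hβ : β ∈ Set.Icc (0 : ℝ) 1)
    (hγ : ∀ i, γ i ∈ Set.Icc (0 : ℝ) 1) {mStar : Fin N → ℝ}
    (hStar : mStar ∈ allocations N) (hM : IsRewardModel μ ℱ β γ T m s)
    (hP : ∀ ω, IsPlay β T (fun t => m t ω) (fun t => s t ω)) :
    ∫ ω, regret β γ mStar T (fun t => m t ω) ∂μ ≤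
      (N : ℝ) ^ 2 + regretConstant N β * (1 + Real.log T) * (T : ℝ) ^ ((1 + β) / 2) := by
  have hB := regretConstant_nonneg N β
  have hlog : 0 ≤ Real.log T := Real.log_natCast_nonneg T
  rcases eq_or_lt_of_le hβ.1 with rfl | hβ0
  -- For `β = 0` every allocation earns `∑ i, γ i`, since `0 ^ 0 = 1`.
  · have : ∀ ω, regret 0 γ mStar T (fun t => m t ω) = 0 := fun ω => by
      simp [regret, expectedReward]
    simp only [this, integral_zero]
    positivity
  rw [hM.integral_regret_eq hβ.1 hγ hP]
  rcases eq_or_lt_of_le hβ.2 with rfl | hβ1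
  -- For `β = 1` the target is linear in `T`, so the trivial bound `N` per round suffices.
  · calc _ ≤ ∑ t ∈ Finset.Icc 1 T, (N : ℝ) := Finset.sum_le_sum fun t ht => by
          rw [Finset.mem_Icc] at ht
          exact hM.integral_round_regret_le_card hβ.1 hγ hStar hP ht.1 ht.2
      _ = N * T := by simp [mul_comm]
      _ ≤ regretConstant N 1 * (1 + Real.log T) * T := by
          gcongr
          nlinarith [natCast_le_regretConstant N 1]
      _ ≤ _ := by norm_num
  have hK : 0 ≤ Real.log T / gramConstant N β + 3 / 2 := by unfold gramConstant; positivity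
  set K := Real.log T / gramConstant N β + 3 / 2
  have hw : ∀ t : ℕ, confidenceWidth β t = (t : ℝ) ^ ((1 + β) / 2 - 1) := fun t => by
    unfold confidenceWidth; ring_nf
  have hw0 : ∀ t : ℕ, 0 ≤ confidenceWidth β t := fun t => Real.rpow_nonneg (Nat.cast_nonneg t) _
  calc _ ≤ ∑ t ∈ Finset.Icc 1 T,
          ((if t ≤ N then (N : ℝ) else 0) + 2 * (N * (confidenceWidth β t * K))) :=
        Finset.sum_le_sum fun t ht => by
          rw [Finset.mem_Icc] at ht
          have hnn : 0 ≤ 2 * (N * (confidenceWidth β t * K)) := by have := hw0 t; positivity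
          split_ifs with h
          · have := hM.integral_round_regret_le_card hβ.1 hγ hStar hP ht.1 ht.2
            linarith
          · rw [zero_add]
            exact hM.integral_round_regret_le hβ0 hβ1 hγ hStar hP (by omega) ht.2
    _ = ∑ t ∈ Finset.Icc 1 T, (if t ≤ N then (N : ℝ) else 0) +
          2 * N * K * ∑ t ∈ Finset.Icc 1 T, (t : ℝ) ^ ((1 + β) / 2 - 1) := by
        rw [Finset.sum_add_distrib, Finset.mul_sum]
        congr 1
        refine Finset.sum_congr rfl fun t _ => ?_
        rw [hw]; ring
    _ ≤ (N : ℝ) ^ 2 + 2 * N * K * (2 * (T : ℝ) ^ ((1 + β) / 2)) := by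
        gcongr
        · rw [← Finset.sum_filter, Finset.sum_const, nsmul_eq_mul, sq]
          gcongr
          calc _ ≤ (Finset.Icc 1 N).card := Finset.card_le_card fun t ht => by
                simp only [Finset.mem_filter, Finset.mem_Icc] at ht ⊢; omega
            _ = N := by simp
        · exact sum_Icc_rpow_sub_one_le (by linarith) (by linarith) T
    _ ≤ _ := by
        have hK2 : K ≤ (1 / gramConstant N β + 3 / 2) * (1 + Real.log T) := by
          have : 0 ≤ 1 / gramConstant N β := by unfold gramConstant; positivity
          have e : K = Real.log T * (1 / gramConstant N β) + 3 / 2 := by simp only [K]; ring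
          rw [e]
          nlinarith
        have e : 2 * N * K * (2 * (T : ℝ) ^ ((1 + β) / 2)) =
            4 * N * K * (T : ℝ) ^ ((1 + β) / 2) := by ring
        rw [e]
        unfold regretConstant
        rw [mul_assoc (4 * (N : ℝ)) (1 / gramConstant N β + 3 / 2)]
        gcongr

end

/-- Either `B ≤ 1 + log T`, and the extra logarithm absorbs `B`, or `T ≤ exp B`, and everything but
one logarithm is bounded independently of `T`. -/
theorem mul_one_add_log_mul_rpow_le {B p : ℝ} (hB : 0 ≤ B) (hp : 0 < p) (hp1 : p ≤ 1) (T : ℕ) :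
    B * (1 + Real.log T) * (T : ℝ) ^ p ≤
      (B * Real.exp B + (T : ℝ) ^ p) * (1 + Real.log T) ^ 2 := by
  rcases Nat.eq_zero_or_pos T with rfl | hT
  · simp [Real.zero_rpow hp.ne']; positivity
  have hT1 : (1 : ℝ) ≤ T := by exact_mod_cast hT
  have hlog : 0 ≤ Real.log T := Real.log_nonneg hT1
  have hTp : 0 ≤ (T : ℝ) ^ p := by positivity
  rcases le_total B (1 + Real.log T) with h | h
  · calc B * (1 + Real.log T) * (T : ℝ) ^ p ≤
          (1 + Real.log T) * (1 + Real.log T) * (T : ℝ) ^ p := by gcongr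
      _ = (0 + (T : ℝ) ^ p) * (1 + Real.log T) ^ 2 := by ring
      _ ≤ _ := by gcongr; positivity
  · have h1 : (T : ℝ) ^ p ≤ Real.exp B := by
      calc (T : ℝ) ^ p ≤ (T : ℝ) ^ (1 : ℝ) := Real.rpow_le_rpow_of_exponent_le hT1 hp1
        _ = Real.exp (Real.log T) := by rw [Real.rpow_one, Real.exp_log (by linarith)]
        _ ≤ _ := Real.exp_le_exp.2 (by linarith)
    calc B * (1 + Real.log T) * (T : ℝ) ^ p ≤ B * (1 + Real.log T) * Real.exp B := by gcongr
      _ = (B * Real.exp B + 0) * (1 + Real.log T) := by ring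
      _ ≤ (B * Real.exp B + (T : ℝ) ^ p) * (1 + Real.log T) ^ 2 := by
        gcongr
        nlinarith

end UCBRA

theorem mainTheorem2 :
    ∃ (C : ℝ) (k : ℕ) (F : ℕ → ℝ → ℝ), 0 < C ∧ (∀ N β, 0 ≤ F N β) ∧
      ∀ (N : ℕ) (β : ℝ), β ∈ Set.Icc (0 : ℝ) 1 →
      ∀ (γ : Fin N → ℝ), (∀ i, γ i ∈ Set.Icc (0 : ℝ) 1) →
      ∀ (mStar : Fin N → ℝ), UCBRA.IsOptimalAllocation β γ mStar →
      ∀ (T : ℕ) (Ω : Type*) (mΩ : MeasurableSpace Ω) (μ : MeasureTheory.Measure Ω),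
        MeasureTheory.IsProbabilityMeasure μ →
      ∀ (ℱ : MeasureTheory.Filtration ℕ mΩ) (m s : ℕ → Ω → Fin N → ℝ),
        UCBRA.IsRewardModel μ ℱ β γ T m s →
        (∀ ω, UCBRA.IsPlay β T (fun t => m t ω) (fun t => s t ω)) →
        MeasureTheory.Integrable (fun ω => UCBRA.regret β γ mStar T (fun t => m t ω)) μ ∧
        ∫ ω, UCBRA.regret β γ mStar T (fun t => m t ω) ∂μ ≤
          C * (F N β + (T : ℝ) ^ ((1 + β) / 2)) * (1 + Real.log T) ^ k := by
  refine ⟨1, 2, fun N β => (N : ℝ) ^ 2 +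
    UCBRA.regretConstant N β * Real.exp (UCBRA.regretConstant N β), one_pos, fun N β => ?_, ?_⟩
  · have := UCBRA.regretConstant_nonneg N β
    positivity
  intro N β hβ γ hγ mStar hStar T Ω mΩ μ hμ ℱ m s hM hP
  refine ⟨hM.integrable_regret hβ.1 hγ hP, ?_⟩
  have hlog : 0 ≤ Real.log T := Real.log_natCast_nonneg T
  have h1 := hM.integral_regret_le hβ hγ hStar.1 hP
  have h2 := UCBRA.mul_one_add_log_mul_rpow_le (UCBRA.regretConstant_nonneg N β)
    (p := (1 + β) / 2) (by linarith [hβ.1]) (by linarith [hβ.2]) T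
  have h3 : (N : ℝ) ^ 2 ≤ (N : ℝ) ^ 2 * (1 + Real.log T) ^ 2 :=
    le_mul_of_one_le_right (sq_nonneg _) (one_le_pow₀ (by linarith))
  linarith
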